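/- For $d\ge 1$, call a finite family of points in $\mathbb{R}^d$ \emph{convexly independent} if its members are distinct and none of them lies in the convex hull of the others. Let - $E_d(n)$ be the maximum number of (unordered) pairs of distinct points that can be selected from a set of $n$ points in $\mathbb{R}^d$ such that the midpoints of the selected pairs are convexly independent; - $M_d(m,n)$ be the maximum size of a convexly independent subset of the Minkowski sum $P+Q$, over all sets $P$ of $m$ points and $Q$ of $n$ points in $\mathbb{R}^d$; - $W_d(n)$ be the maximum number of pairwise nonparallel segments of unit length with endpoints in a set of $n$ points, over all sets of $n$ points in $\mathbb{R}^d$ and all strictly convex norms on $\mathbb{R}^d$ (two segments on a common line count as parallel). Theorem. In the plane, $E_2(n)$, $M_2(n,n)$ and $W_2(n)$ are all in $\Omega(n\sqrt{\log n})$: there is a constant $c>0$ such that for all integers $n\ge 2$, $$E_2(n)\ge c\,n\sqrt{\log n},\qquad M_2(n,n)\ge c\,n\sqrt{\log n},\qquad W_2(n)\ge c\,n\sqrt{\log n}.$$ -/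

import Mathlib

open scoped Pointwise Affine

namespace MinkowskiSum

/-- The space `ℝ^d`. -/
abbrev Pt (d : ℕ) : Type := EuclideanSpace ℝ (Fin d)

/-- `G` is a set of unordered pairs of distinct points of `P`, i.e. the edge set of a graph
on the vertex set `P`. -/
def IsPairSet {d : ℕ} (P : Finset (Pt d)) (G : Finset (Sym2 (Pt d))) : Prop :=
  ∀ e ∈ G, (∀ x ∈ e, x ∈ P) ∧ ¬ e.IsDiag

/-- The midpoint of an unordered pair. -/
noncomputable def pairMidpoint {d : ℕ} : Sym2 (Pt d) → Pt d :=
  Sym2.lift ⟨fun x y => midpoint ℝ x y, fun x y => midpoint_comm x y⟩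

/-- The sizes of sets of pairs from `n` points of `ℝ^d` with convexly independent midpoints.
`ConvexIndependent` is applied to the family of midpoints, so different pairs
have different midpoints, each of them a vertex of the convex hull of all the midpoints. -/
def midpointSizes (d n : ℕ) : Set ℕ :=
  {k | ∃ (P : Finset (Pt d)) (G : Finset (Sym2 (Pt d))), P.card = n ∧ IsPairSet P G ∧
    ConvexIndependent ℝ (fun e : G => pairMidpoint (e : Sym2 (Pt d))) ∧ G.card = k}

/-- `E_d(n)`: the maximum number of pairs of points from a set of `n` points in `ℝ^d` whose
midpoints are convexly independent. -/
noncomputable def maxMidpointPairs (d n : ℕ) : ℕ := sSup (midpointSizes d n)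

/-- The sizes of convexly independent subsets `S ⊆ P + Q` with `|P| = m`, `|Q| = n`. -/
def sumSizes (d m n : ℕ) : Set ℕ :=
  {k | ∃ P Q S : Finset (Pt d), P.card = m ∧ Q.card = n ∧
    (S : Set (Pt d)) ⊆ (P : Set (Pt d)) + (Q : Set (Pt d)) ∧
    ConvexIndependent ℝ (fun s : S => (s : Pt d)) ∧ S.card = k}

/-- `M_d(m,n)`: the maximum size of a convexly independent subset of `P + Q` over all sets
`P` of `m` points and `Q` of `n` points in `ℝ^d`. -/
noncomputable def maxSumIndependent (d m n : ℕ) : ℕ := sSup (sumSizes d m n)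

/-- A seminorm on `ℝ^d` is a strictly convex norm if it is definite and its closed unit ball
is strictly convex. (All norms on `ℝ^d` induce the usual topology, to which the interior in
`StrictConvex` refers.) -/
def IsStrictlyConvexNorm {d : ℕ} (N : Seminorm ℝ (Pt d)) : Prop :=
  (∀ x, N x = 0 → x = 0) ∧ StrictConvex ℝ (N.closedBall 0 1)

/-- Any two different pairs in `G` span nonparallel lines (a line is parallel to itself). -/
def PairwiseNonparallel {d : ℕ} (G : Finset (Sym2 (Pt d))) : Prop :=
  ∀ x y z w : Pt d, s(x, y) ∈ G → s(z, w) ∈ G → s(x, y) ≠ s(z, w) →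
    ¬ (line[ℝ, x, y] ∥ line[ℝ, z, w])

/-- The sizes of sets of pairwise nonparallel unit-length pairs from `n` points of `ℝ^d`
with respect to some strictly convex norm on `ℝ^d`. -/
def unitSizes (d n : ℕ) : Set ℕ :=
  {k | ∃ (N : Seminorm ℝ (Pt d)) (P : Finset (Pt d)) (G : Finset (Sym2 (Pt d))),
    IsStrictlyConvexNorm N ∧ P.card = n ∧ IsPairSet P G ∧
    (∀ x y : Pt d, s(x, y) ∈ G → N (x - y) = 1) ∧ PairwiseNonparallel G ∧ G.card = k}

/-- `W_d(n)`: the maximum number of pairwise nonparallel segments of unit length among `n`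
points of `ℝ^d`, over all sets of `n` points and all strictly convex norms on `ℝ^d`. -/
noncomputable def maxNonparallelUnit (d n : ℕ) : ℕ := sSup (unitSizes d n)

/-! The three suprema are maxima of nonempty bounded sets, for every `d > 0`. -/

theorem IsPairSet.card_le {d : ℕ} {P : Finset (Pt d)} {G : Finset (Sym2 (Pt d))}
    (h : IsPairSet P G) : G.card ≤ P.sym2.card :=
  Finset.card_le_card fun e he => Finset.mem_sym2_iff.2 (h e he).1

theorem exists_card_eq {d : ℕ} (hd : 0 < d) (n : ℕ) : ∃ P : Finset (Pt d), P.card = n := by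
  have : Nonempty (Fin d) := ⟨⟨0, hd⟩⟩
  have : Infinite (Pt d) := Module.Free.infinite ℝ (Pt d)
  exact Infinite.exists_subset_card_eq _ n |>.imp fun _ h => h

theorem maxMidpointPairs_isGreatest {d : ℕ} (hd : 0 < d) (n : ℕ) :
    IsGreatest (midpointSizes d n) (maxMidpointPairs d n) := by
  have hb : BddAbove (midpointSizes d n) := by
    refine ⟨(n + 1).choose 2, ?_⟩
    rintro k ⟨P, G, hP, hG, -, rfl⟩
    simpa [Finset.card_sym2, hP] using hG.card_le
  obtain ⟨P, hP⟩ := exists_card_eq hd n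
  refine ⟨Nat.sSup_mem ⟨0, P, ∅, hP, by simp [IsPairSet], ?_, rfl⟩ hb, fun k hk => le_csSup hb hk⟩
  intro s x
  exact absurd x.2 (Finset.notMem_empty _)

theorem maxSumIndependent_isGreatest {d : ℕ} (hd : 0 < d) (m n : ℕ) :
    IsGreatest (sumSizes d m n) (maxSumIndependent d m n) := by
  classical
  have hb : BddAbove (sumSizes d m n) := by
    refine ⟨m * n, ?_⟩
    rintro k ⟨P, Q, S, rfl, rfl, hS, -, rfl⟩
    rw [← Finset.coe_add, Finset.coe_subset] at hS
    exact (Finset.card_le_card hS).trans Finset.card_add_le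
  obtain ⟨P, hP⟩ := exists_card_eq hd m
  obtain ⟨Q, hQ⟩ := exists_card_eq hd n
  refine ⟨Nat.sSup_mem ⟨0, P, Q, ∅, hP, hQ, by simp, ?_, rfl⟩ hb, fun k hk => le_csSup hb hk⟩
  intro s x
  exact absurd x.2 (Finset.notMem_empty _)

theorem isStrictlyConvexNorm_euclidean (d : ℕ) :
    IsStrictlyConvexNorm (normSeminorm ℝ (Pt d)) := by
  refine ⟨fun x hx => by simpa using hx, ?_⟩
  rw [closedBall_normSeminorm]
  exact strictConvex_closedBall ℝ _ _

theorem maxNonparallelUnit_isGreatest {d : ℕ} (hd : 0 < d) (n : ℕ) :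
    IsGreatest (unitSizes d n) (maxNonparallelUnit d n) := by
  have hb : BddAbove (unitSizes d n) := by
    refine ⟨(n + 1).choose 2, ?_⟩
    rintro k ⟨N, P, G, -, hP, hG, -, -, rfl⟩
    simpa [Finset.card_sym2, hP] using hG.card_le
  obtain ⟨P, hP⟩ := exists_card_eq hd n
  exact ⟨Nat.sSup_mem ⟨0, _, P, ∅, isStrictlyConvexNorm_euclidean d, hP, by simp [IsPairSet],
    by simp, by simp [PairwiseNonparallel], rfl⟩ hb, fun k hk => le_csSup hb hk⟩

end MinkowskiSum

/-!
Put `p = (x, x² + 2ey)` for a point `(x, y)` and `q = (em, (em)² - 2eb)` for a line `y = mx + b`.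
If the point is on the line, then `p + q = (u, u²)` with `u = x + em`. So the incidences of
`n` points and lines yield pairs whose sums lie on a parabola. After a generic shear and for
generic `e` the abscissas `u` are distinct, and then the sums and the midpoints of the pairs are
convexly independent.

For unit segments, reflect the points `q` in the origin and lower the points `p` by a large `T`:
the segments become the vectors `(u, u² - T)`, which lie on the boundary of the lens
`x² + |y| ≤ T`. The lens is the unit ball of a strictly convex norm.

Finally, the points `(x, y)` and the lines `y = mx + b` with integers `0 ≤ x, m < k`,
`0 ≤ b < k²` and `0 ≤ y < 2k² - 1` have at least `k⁴` incidences, hence all three maxima are of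
order at least `n^(4/3)`.
-/

namespace MinkowskiSum

section IndexedFamilies

variable {ι : Type*} [Fintype ι] {d n : ℕ} {p q : ι → Pt d} {P : Finset (Pt d)}

theorem exists_superset_card_eq (hd : 0 < d) (hP : P.card ≤ n) :
    ∃ P' : Finset (Pt d), P ⊆ P' ∧ P'.card = n := by
  have : Nonempty (Fin d) := ⟨⟨0, hd⟩⟩
  have : Infinite (Pt d) := Module.Free.infinite ℝ (Pt d)
  exact Infinite.exists_superset_card_eq P n hP

theorem isPairSet_map (e : ι ↪ Sym2 (Pt d)) (he : ∀ i, e i = s(p i, q i)) (hp : ∀ i, p i ∈ P)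
    (hq : ∀ i, q i ∈ P) (hne : ∀ i, p i ≠ q i) : IsPairSet P (Finset.univ.map e) := by
  intro s hs
  obtain ⟨i, -, rfl⟩ := Finset.mem_map.1 hs
  rw [he]
  refine ⟨fun x hx => ?_, by simpa using hne i⟩
  rcases Sym2.mem_iff.1 hx with rfl | rfl
  exacts [hp i, hq i]

theorem convexIndependent_map {𝕜 E α : Type*} [Semiring 𝕜] [PartialOrder 𝕜] [AddCommGroup E]
    [Module 𝕜 E] (e : ι ↪ α) {g : α → E} (h : ConvexIndependent 𝕜 fun i => g (e i)) :
    ConvexIndependent 𝕜 fun a : Finset.univ.map e => g a := by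
  have hpre : ∀ a : Finset.univ.map e, ∃ i, e i = a := fun a => by
    simpa using Finset.mem_map.1 a.2
  choose i hi using hpre
  have hinj : Function.Injective i := fun a b hab =>
    Subtype.ext ((hi a).symm.trans ((congrArg e hab).trans (hi b)))
  simpa only [Function.comp_def, Function.Embedding.coeFn_mk, hi]
    using h.comp_embedding ⟨i, hinj⟩

theorem card_le_maxMidpointPairs (hd : 0 < d) (hP : P.card ≤ n) (hp : ∀ i, p i ∈ P)
    (hq : ∀ i, q i ∈ P) (hne : ∀ i, p i ≠ q i)
    (hconv : ConvexIndependent ℝ fun i => midpoint ℝ (p i) (q i)) :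
    Fintype.card ι ≤ maxMidpointPairs d n := by
  obtain ⟨P', hPP', hP'⟩ := exists_superset_card_eq hd hP
  let e : ι ↪ Sym2 (Pt d) := ⟨fun i => s(p i, q i), fun i j hij =>
    hconv.injective (congrArg pairMidpoint hij)⟩
  exact (maxMidpointPairs_isGreatest hd n).2 ⟨P', Finset.univ.map e, hP',
    isPairSet_map e (fun _ => rfl) (fun i => hPP' (hp i)) (fun i => hPP' (hq i)) hne,
    convexIndependent_map e (g := pairMidpoint) hconv, Finset.card_map e⟩

theorem card_le_maxSumIndependent {m : ℕ} {Q : Finset (Pt d)} (hd : 0 < d) (hP : P.card ≤ m)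
    (hQ : Q.card ≤ n) (hp : ∀ i, p i ∈ P) (hq : ∀ i, q i ∈ Q)
    (hconv : ConvexIndependent ℝ fun i => p i + q i) :
    Fintype.card ι ≤ maxSumIndependent d m n := by
  obtain ⟨P', hPP', hP'⟩ := exists_superset_card_eq hd hP
  obtain ⟨Q', hQQ', hQ'⟩ := exists_superset_card_eq hd hQ
  let e : ι ↪ Pt d := ⟨fun i => p i + q i, hconv.injective⟩
  refine (maxSumIndependent_isGreatest hd m n).2 ⟨P', Q', Finset.univ.map e, hP', hQ', ?_,
    convexIndependent_map e (g := id) hconv, Finset.card_map e⟩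
  intro x hx
  obtain ⟨i, -, rfl⟩ := Finset.mem_map.1 hx
  exact Set.add_mem_add (hPP' (hp i)) (hQQ' (hq i))

theorem affineSpan_pair_eq_of_sym2_eq {x y z w : Pt d} (h : s(x, y) = s(z, w)) :
    line[ℝ, x, y] = line[ℝ, z, w] := by
  rcases Sym2.eq_iff.1 h with ⟨rfl, rfl⟩ | ⟨rfl, rfl⟩
  exacts [rfl, by rw [Set.pair_comm]]

theorem card_le_maxNonparallelUnit {N : Seminorm ℝ (Pt d)} (hd : 0 < d)
    (hN : IsStrictlyConvexNorm N) (hP : P.card ≤ n) (hp : ∀ i, p i ∈ P) (hq : ∀ i, q i ∈ P)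
    (hunit : ∀ i, N (p i - q i) = 1)
    (hpar : ∀ i j, line[ℝ, p i, q i] ∥ line[ℝ, p j, q j] → i = j) :
    Fintype.card ι ≤ maxNonparallelUnit d n := by
  obtain ⟨P', hPP', hP'⟩ := exists_superset_card_eq hd hP
  have hne : ∀ i, p i ≠ q i := fun i hpq => by simpa [hpq] using hunit i
  let e : ι ↪ Sym2 (Pt d) := ⟨fun i => s(p i, q i), fun i j hij =>
    hpar i j (by rw [affineSpan_pair_eq_of_sym2_eq hij])⟩
  refine (maxNonparallelUnit_isGreatest hd n).2 ⟨N, P', Finset.univ.map e, hN, hP',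
    isPairSet_map e (fun _ => rfl) (fun i => hPP' (hp i)) (fun i => hPP' (hq i)) hne,
    ?_, ?_, Finset.card_map e⟩
  · intro x y hxy
    obtain ⟨i, -, hi⟩ := Finset.mem_map.1 hxy
    rcases Sym2.eq_iff.1 hi with ⟨rfl, rfl⟩ | ⟨rfl, rfl⟩
    exacts [hunit i, by rw [map_sub_rev, hunit i]]
  · intro x y z w hxy hzw hdistinct hpara
    obtain ⟨i, -, hi⟩ := Finset.mem_map.1 hxy
    obtain ⟨j, -, hj⟩ := Finset.mem_map.1 hzw
    rw [← affineSpan_pair_eq_of_sym2_eq hi, ← affineSpan_pair_eq_of_sym2_eq hj] at hpara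
    exact hdistinct (by rw [← hi, ← hj, hpar i j hpara])

end IndexedFamilies

section Norms

theorem exists_isStrictlyConvexNorm_closedBall_eq {d : ℕ} {K : Set (Pt d)}
    (hconv : StrictConvex ℝ K) (hneg : ∀ ⦃x⦄, x ∈ K → -x ∈ K) (hzero : K ∈ nhds 0)
    (hclosed : IsClosed K) (hbdd : Bornology.IsBounded K) :
    ∃ N : Seminorm ℝ (Pt d), IsStrictlyConvexNorm N ∧ N.closedBall 0 1 = K := by
  have habs : Absorbent ℝ K := absorbent_nhds_zero hzero
  let N := gaugeSeminorm ((balanced_iff_neg_mem hconv.convex).2 hneg) hconv.convex habs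
  have hball : N.closedBall 0 1 = K := by
    ext x
    rw [Seminorm.mem_closedBall_zero]
    exact (gauge_le_one_iff_mem_closure hconv.convex hzero).trans (by rw [hclosed.closure_eq])
  refine ⟨N, ⟨fun x hx => ?_, hball.symm ▸ hconv⟩, hball⟩
  exact (gauge_eq_zero habs ((NormedSpace.isVonNBounded_iff ℝ).2 hbdd)).1 hx

/-- The region between the parabolas `y = x² - T` and `y = T - x²`: the unit ball of the norm
for which the unit segments are counted. -/
def lens (T : ℝ) : Set (Pt 2) := {v | v 0 ^ 2 + |v 1| ≤ T}

theorem setOf_sq_add_abs_lt_subset_interior_lens (T : ℝ) :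
    {v : Pt 2 | v 0 ^ 2 + |v 1| < T} ⊆ interior (lens T) := by
  have hopen : IsOpen {v : Pt 2 | v 0 ^ 2 + |v 1| < T} := isOpen_lt (by fun_prop) continuous_const
  exact interior_maximal (fun _ hv => le_of_lt (Set.mem_ofPred_eq ▸ hv)) hopen

theorem strictConvex_lens (T : ℝ) : StrictConvex ℝ (lens T) := by
  intro x hx y hy hxy a b ha hb hab
  rw [lens, Set.mem_ofPred_eq] at hx hy
  refine setOf_sq_add_abs_lt_subset_interior_lens T ?_
  change (a * x 0 + b * y 0) ^ 2 + |a * x 1 + b * y 1| < T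
  rcases eq_or_ne (x 0) (y 0) with h0 | h0
  · have h1 : x 1 ≠ y 1 := fun h1 => hxy (by ext i; fin_cases i; exacts [h0, h1])
    have hmem : ∀ r : ℝ, y 0 ^ 2 + |r| ≤ T → r ∈ Set.Icc (-(T - y 0 ^ 2)) (T - y 0 ^ 2) :=
      fun r hr => abs_le.1 (by linarith)
    have hint := strictConvex_Icc (𝕜 := ℝ) _ _ (hmem _ (h0 ▸ hx)) (hmem _ hy) h1 ha hb hab
    rw [interior_Icc] at hint
    have habs : |a * x 1 + b * y 1| < T - y 0 ^ 2 := abs_lt.2 hint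
    rw [h0, ← add_mul, hab, one_mul]
    linarith
  · have hsq : (a * x 0 + b * y 0) ^ 2 < a * x 0 ^ 2 + b * y 0 ^ 2 :=
      (even_two.strictConvexOn_pow two_ne_zero).2 trivial trivial h0 ha hb hab
    have habs : |a * x 1 + b * y 1| ≤ a * |x 1| + b * |y 1| := by
      simpa only [abs_mul, abs_of_pos ha, abs_of_pos hb] using abs_add_le (a * x 1) (b * y 1)
    calc (a * x 0 + b * y 0) ^ 2 + |a * x 1 + b * y 1|
        < a * (x 0 ^ 2 + |x 1|) + b * (y 0 ^ 2 + |y 1|) := by linarith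
      _ ≤ a * T + b * T := by gcongr
      _ = T := by rw [← add_mul, hab, one_mul]

theorem lens_mem_nhds_zero {T : ℝ} (hT : 0 < T) : lens T ∈ nhds 0 :=
  mem_interior_iff_mem_nhds.1 (setOf_sq_add_abs_lt_subset_interior_lens T (by simpa using hT))

theorem isClosed_lens (T : ℝ) : IsClosed (lens T) :=
  isClosed_le (by fun_prop) continuous_const

theorem isBounded_lens (T : ℝ) : Bornology.IsBounded (lens T) := by
  refine isBounded_iff_forall_norm_le.2 ⟨√(T + T ^ 2), fun v hv => ?_⟩
  rw [lens, Set.mem_ofPred_eq] at hv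
  rw [EuclideanSpace.norm_eq, Fin.sum_univ_two]
  simp only [Real.norm_eq_abs, sq_abs]
  have h1 : |v 1| ≤ T := by nlinarith [sq_nonneg (v 0)]
  have h1sq : v 1 ^ 2 ≤ T ^ 2 := sq_le_sq.2 (h1.trans (le_abs_self T))
  gcongr
  linarith [abs_nonneg (v 1)]

theorem exists_isStrictlyConvexNorm_eq_one {T : ℝ} (hT : 0 < T) :
    ∃ N : Seminorm ℝ (Pt 2), IsStrictlyConvexNorm N ∧
      ∀ v : Pt 2, v 0 ^ 2 + |v 1| = T → N v = 1 := by
  obtain ⟨N, hN, hball⟩ := exists_isStrictlyConvexNorm_closedBall_eq (strictConvex_lens T)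
    (fun x hx => by simpa [lens] using hx) (lens_mem_nhds_zero hT) (isClosed_lens T)
    (isBounded_lens T)
  have hmem : ∀ v, N v ≤ 1 ↔ v 0 ^ 2 + |v 1| ≤ T := fun v => by
    rw [← Seminorm.mem_closedBall_zero, hball, lens, Set.mem_ofPred_eq]
  refine ⟨N, hN, fun v hv => ((hmem v).2 hv.le).antisymm (le_of_not_gt fun hlt => ?_)⟩
  have hpos : 0 < N v := (apply_nonneg N v).lt_of_ne' fun h0 =>
    hT.ne (by simpa [hN.1 v h0] using hv)
  -- Rescaling `v` to norm one would push it out of the lens.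
  set r := (N v)⁻¹
  have hr : 1 < r := (one_lt_inv₀ hpos).2 hlt
  have hrv : N (r • v) ≤ 1 := by
    rw [map_smul_eq_mul, Real.norm_of_nonneg (by positivity), inv_mul_cancel₀ hpos.ne']
  have hle := (hmem _).1 hrv
  simp only [PiLp.smul_apply, smul_eq_mul, abs_mul, abs_of_pos (zero_lt_one.trans hr)] at hle
  have hsq : r * v 0 ^ 2 ≤ (r * v 0) ^ 2 := by nlinarith [sq_nonneg (v 0)]
  nlinarith

end Norms

section ParabolicSystems

theorem convexIndependent_of_forall_exists_lt {𝕜 E ι : Type*} [Field 𝕜] [LinearOrder 𝕜]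
    [IsStrictOrderedRing 𝕜] [AddCommGroup E] [Module 𝕜 E] {f : ι → E}
    (h : ∀ i, ∃ l : E →ₗ[𝕜] 𝕜, ∀ j, j ≠ i → l (f i) < l (f j)) : ConvexIndependent 𝕜 f := by
  rw [convexIndependent_iff_notMem_convexHull_sdiff]
  intro i s hi
  obtain ⟨l, hl⟩ := h i
  have hsub : convexHull 𝕜 (f '' (s \ {i})) ⊆ {v | l (f i) < l v} := by
    refine convexHull_min ?_ (convex_halfSpace_gt l.isLinear _)
    rintro _ ⟨j, ⟨-, hj⟩, rfl⟩
    exact hl j hj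
  exact lt_irrefl _ (hsub hi)

theorem convexIndependent_of_parabola {ι : Type*} {f : ι → Pt 2} {a : ℝ} (ha : 0 < a)
    (hf : ∀ i, f i 1 = a * f i 0 ^ 2) (hinj : Function.Injective fun i => f i 0) :
    ConvexIndependent ℝ f := by
  refine convexIndependent_of_forall_exists_lt fun i => ?_
  -- The tangent line of the parabola at `f i` supports it there.
  refine ⟨EuclideanSpace.projₗ 1 - (2 * a * f i 0) • EuclideanSpace.projₗ 0, fun j hj => ?_⟩
  have hsq : 0 < a * (f j 0 - f i 0) ^ 2 :=
    mul_pos ha (sq_pos_of_ne_zero (sub_ne_zero.2 fun h => hj (hinj h)))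
  suffices f i 1 - 2 * a * f i 0 * f i 0 < f j 1 - 2 * a * f i 0 * f j 0 by simpa using this
  rw [hf i, hf j]
  linarith

theorem mul_eq_mul_of_parallel {d : ℕ} {x y z w : Pt d} (h : line[ℝ, x, y] ∥ line[ℝ, z, w])
    (i j : Fin d) : (x - y) i * (z - w) j = (x - y) j * (z - w) i := by
  have hzw : z -ᵥ w ∈ vectorSpan ℝ {x, y} := by
    rw [← direction_affineSpan, h.direction_eq, direction_affineSpan]
    exact vsub_mem_vectorSpan ℝ (by simp) (by simp)
  obtain ⟨r, hr⟩ := mem_vectorSpan_pair.1 hzw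
  rw [vsub_eq_sub, vsub_eq_sub] at hr
  rw [← hr, PiLp.smul_apply, PiLp.smul_apply, smul_eq_mul, smul_eq_mul]
  ring

/-- A family of pairs of points of the plane whose sums lie on the parabola `y = x²` and have
distinct abscissas. Each such family bounds all three maxima from below. -/
structure IsParabolicSystem {ι : Type*} (p q : ι → Pt 2) : Prop where
  apply_one : ∀ i, (p i + q i) 1 = (p i + q i) 0 ^ 2
  injective_apply_zero : Function.Injective fun i => (p i + q i) 0

namespace IsParabolicSystem

variable {ι : Type*} {p q : ι → Pt 2} {P Q : Finset (Pt 2)} {n : ℕ}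

theorem translate (h : IsParabolicSystem p q) (v : Pt 2) :
    IsParabolicSystem (fun i => p i + v) (fun i => q i - v) where
  apply_one := by simpa only [add_add_sub_cancel] using h.apply_one
  injective_apply_zero := by simpa only [add_add_sub_cancel] using h.injective_apply_zero

theorem convexIndependent_add (h : IsParabolicSystem p q) :
    ConvexIndependent ℝ fun i => p i + q i :=
  convexIndependent_of_parabola one_pos (fun i => by rw [one_mul, h.apply_one])
    h.injective_apply_zero

theorem convexIndependent_midpoint (h : IsParabolicSystem p q) :
    ConvexIndependent ℝ fun i => midpoint ℝ (p i) (q i) := by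
  have hmid : ∀ i k, midpoint ℝ (p i) (q i) k = (p i + q i) k / 2 := fun i k => by
    simp only [midpoint_eq_smul_add, PiLp.smul_apply, invOf_eq_inv, smul_eq_mul]
    ring
  refine convexIndependent_of_parabola two_pos (fun i => ?_) fun i j hij => ?_
  · rw [hmid, hmid, h.apply_one]
    ring
  · simp only [hmid] at hij
    exact h.injective_apply_zero (by simpa using hij)

variable [Fintype ι]

theorem card_le_maxSumIndependent {m : ℕ} (h : IsParabolicSystem p q) (hP : P.card ≤ m)
    (hQ : Q.card ≤ n) (hp : ∀ i, p i ∈ P) (hq : ∀ i, q i ∈ Q) :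
    Fintype.card ι ≤ maxSumIndependent 2 m n :=
  MinkowskiSum.card_le_maxSumIndependent two_pos hP hQ hp hq h.convexIndependent_add

open Classical in
theorem card_le_maxMidpointPairs (h : IsParabolicSystem p q) (hPQ : P.card + Q.card ≤ n)
    (hp : ∀ i, p i ∈ P) (hq : ∀ i, q i ∈ Q) : Fintype.card ι ≤ maxMidpointPairs 2 n := by
  -- Translating by a generic vector separates `p i` from `q i`.
  obtain ⟨v, hv⟩ : ∃ v : Pt 2, ∀ i, p i + v ≠ q i - v := by
    have : Infinite (Pt 2) := Module.Free.infinite ℝ (Pt 2)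
    obtain ⟨v, hv⟩ := Infinite.exists_notMem_finset
      (Finset.univ.image fun i => (1 / 2 : ℝ) • (q i - p i))
    refine ⟨v, fun i hi => hv (Finset.mem_image.2 ⟨i, Finset.mem_univ i, ?_⟩)⟩
    rw [← eq_sub_iff_add_eq.1 hi]
    module
  refine MinkowskiSum.card_le_maxMidpointPairs two_pos
    (P := P.image (· + v) ∪ Q.image (· - v)) ?_
    (fun i => Finset.mem_union_left _ (Finset.mem_image_of_mem _ (hp i)))
    (fun i => Finset.mem_union_right _ (Finset.mem_image_of_mem _ (hq i))) hv
    (h.translate v).convexIndependent_midpoint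
  exact (Finset.card_union_le _ _).trans
    ((add_le_add Finset.card_image_le Finset.card_image_le).trans hPQ)

open Classical in
theorem card_le_maxNonparallelUnit (h : IsParabolicSystem p q) (hPQ : P.card + Q.card ≤ n)
    (hp : ∀ i, p i ∈ P) (hq : ∀ i, q i ∈ Q) : Fintype.card ι ≤ maxNonparallelUnit 2 n := by
  let u : ι → ℝ := fun i => (p i + q i) 0
  obtain ⟨T, hT, hu⟩ : ∃ T : ℝ, 0 < T ∧ ∀ i, u i ^ 2 < T :=
    ⟨∑ i, u i ^ 2 + 1, by positivity, fun i => lt_add_of_le_of_pos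
      (Finset.single_le_sum (f := fun i => u i ^ 2) (fun _ _ => sq_nonneg _) (Finset.mem_univ i))
      one_pos⟩
  obtain ⟨N, hN, hNone⟩ := exists_isStrictlyConvexNorm_eq_one hT
  -- The segments from `-q i` to `p i - (0, T)` span the vectors `(u, u² - T)` on the lower
  -- arc of the lens.
  have h0 : ∀ i, (p i + !₂[0, -T] - -q i) 0 = u i := fun i => by simp [u]
  have h1 : ∀ i, (p i + !₂[0, -T] - -q i) 1 = u i ^ 2 - T := fun i => by
    rw [← h.apply_one]
    simp
    ring
  refine MinkowskiSum.card_le_maxNonparallelUnit two_pos hN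
    (P := P.image (· + !₂[0, -T]) ∪ Q.image (- ·)) ?_
    (fun i => Finset.mem_union_left _ (Finset.mem_image_of_mem _ (hp i)))
    (fun i => Finset.mem_union_right _ (Finset.mem_image_of_mem _ (hq i)))
    (fun i => hNone _ ?_) fun i j hij => h.injective_apply_zero ?_
  · exact (Finset.card_union_le _ _).trans
      ((add_le_add Finset.card_image_le Finset.card_image_le).trans hPQ)
  · rw [h0, h1, abs_of_neg (sub_neg.2 (hu i))]
    ring
  · have hcross := mul_eq_mul_of_parallel hij 0 1
    rw [h0, h0, h1, h1] at hcross
    have hprod : (u i - u j) * (u i * u j + T) = 0 := by linear_combination -hcross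
    have hpos : 0 < u i * u j + T := by nlinarith [hu i, hu j, sq_nonneg (u i + u j)]
    exact sub_eq_zero.1 ((mul_eq_zero.1 hprod).resolve_right hpos.ne')

end IsParabolicSystem

end ParabolicSystems

section Incidences

variable {K : Type*} [Field K]

/-- The point `a = (x, y)` lies on the line `l = (m, b)` with the equation `y = m x + b`. -/
def Incident (a l : K × K) : Prop := a.2 = l.1 * a.1 + l.2

open Classical in
/-- The incident point-line pairs between a finite set of points and a finite set of
nonvertical lines, given by slope and intercept. -/
noncomputable def incidences (A L : Finset (K × K)) : Finset ((K × K) × K × K) :=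
  {f ∈ A ×ˢ L | Incident f.1 f.2}

theorem mem_incidences {A L : Finset (K × K)} {f : (K × K) × K × K} :
    f ∈ incidences A L ↔ f.1 ∈ A ∧ f.2 ∈ L ∧ Incident f.1 f.2 := by
  simp only [incidences, Finset.mem_filter, Finset.mem_product, and_assoc]

theorem Incident.shear {a l : K × K} {t : K} (h : Incident a l) (ht : 1 + t * l.1 ≠ 0) :
    Incident (a.1 + t * a.2, a.2) (l.1 / (1 + t * l.1), l.2 / (1 + t * l.1)) := by
  unfold Incident at h ⊢
  rw [div_mul_eq_mul_div, ← add_div, eq_div_iff ht]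
  linear_combination h

theorem exists_forall_add_mul_ne_zero [Infinite K] (S : Finset (K × K)) :
    ∃ t : K, ∀ s ∈ S, s ≠ 0 → s.1 + t * s.2 ≠ 0 := by
  classical
  obtain ⟨t, ht⟩ := Infinite.exists_notMem_finset (S.image fun s => -s.1 / s.2)
  refine ⟨t, fun s hs hs0 hst => ?_⟩
  rcases eq_or_ne s.2 0 with h2 | h2
  · exact hs0 (Prod.ext (by simpa [h2] using hst) h2)
  · refine ht (Finset.mem_image.2 ⟨s, hs, ?_⟩)
    rw [div_eq_iff h2]
    linear_combination -hst

theorem injOn_add_mul {S : Set (K × K)} {t : K}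
    (h : ∀ s ∈ S - S, s ≠ 0 → s.1 + t * s.2 ≠ 0) : Set.InjOn (fun s => s.1 + t * s.2) S := by
  intro s hs s' hs' heq
  by_contra hne
  refine h _ (Set.sub_mem_sub hs hs') (sub_ne_zero.2 hne) ?_
  simp only [Prod.fst_sub, Prod.snd_sub]
  linear_combination heq

theorem exists_generic_shear [Infinite K] (A L : Finset (K × K)) :
    ∃ t : K, (∀ l ∈ L, 1 + t * l.1 ≠ 0) ∧ Set.InjOn (fun a => a.1 + t * a.2) (A : Set (K × K)) := by
  classical
  obtain ⟨t, ht⟩ := exists_forall_add_mul_ne_zero ((A - A) ∪ L.image fun l => (1, l.1))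
  refine ⟨t, fun l hl => ht (1, l.1) (Finset.mem_union_right _ (Finset.mem_image_of_mem _ hl))
    (by simp), injOn_add_mul fun s hs => ht s (Finset.mem_union_left _ ?_)⟩
  rwa [← Finset.mem_coe, Finset.coe_sub]

theorem injOn_abscissa_slope {A L : Finset (K × K)} {t : K} (hL : ∀ l ∈ L, 1 + t * l.1 ≠ 0)
    (hA : Set.InjOn (fun a => a.1 + t * a.2) (A : Set (K × K))) :
    Set.InjOn (fun f => (f.1.1 + t * f.1.2, f.2.1 / (1 + t * f.2.1)))
      (incidences A L : Set ((K × K) × K × K)) := by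
  rintro ⟨a, l⟩ hf ⟨a', l'⟩ hf' heq
  obtain ⟨ha, hl, hal⟩ := mem_incidences.1 hf
  obtain ⟨ha', hl', hal'⟩ := mem_incidences.1 hf'
  obtain ⟨habs, hslope⟩ := Prod.ext_iff.1 heq
  obtain rfl : a = a' := hA ha ha' habs
  have hm : l.1 = l'.1 := by
    have := (div_eq_div_iff (hL l hl) (hL l' hl')).1 hslope
    linear_combination this
  have hb : l.2 = l'.2 := by
    unfold Incident at hal hal'
    linear_combination hal' - hal - a.1 * hm
  rw [Prod.ext hm hb]

/-- The point `(x, y)` lifted so that, for every `e`, its sum with `dualPoint e l` lies on the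
parabola if it is on the line `l`. The parameter `e` scales the slopes. -/
noncomputable def liftPoint (e : ℝ) (a : ℝ × ℝ) : Pt 2 := !₂[a.1, a.1 ^ 2 + 2 * e * a.2]

/-- The point dual to the line `y = m x + b`, see `liftPoint`. -/
noncomputable def dualPoint (e : ℝ) (l : ℝ × ℝ) : Pt 2 :=
  !₂[e * l.1, (e * l.1) ^ 2 - 2 * e * l.2]

theorem liftPoint_add_dualPoint_apply_zero (e : ℝ) (a l : ℝ × ℝ) :
    (liftPoint e a + dualPoint e l) 0 = a.1 + e * l.1 := by
  simp [liftPoint, dualPoint]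

theorem Incident.liftPoint_add_dualPoint_apply_one {a l : ℝ × ℝ} (h : Incident a l) (e : ℝ) :
    (liftPoint e a + dualPoint e l) 1 = (liftPoint e a + dualPoint e l) 0 ^ 2 := by
  rw [liftPoint_add_dualPoint_apply_zero]
  simp only [liftPoint, dualPoint, PiLp.add_apply, Matrix.cons_val_one,
    Matrix.cons_val_fin_one]
  unfold Incident at h
  linear_combination 2 * e * h

theorem exists_isParabolicSystem (A L : Finset (ℝ × ℝ)) :
    ∃ φ ψ : ℝ × ℝ → Pt 2, IsParabolicSystem
      (fun f : incidences A L => φ f.1.1) (fun f : incidences A L => ψ f.1.2) := by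
  classical
  obtain ⟨t, hL, hA⟩ := exists_generic_shear A L
  let g : (ℝ × ℝ) × ℝ × ℝ → ℝ × ℝ := fun f => (f.1.1 + t * f.1.2, f.2.1 / (1 + t * f.2.1))
  let S := (incidences A L).image g
  obtain ⟨e, he⟩ := exists_forall_add_mul_ne_zero (S - S)
  have hS : Set.InjOn (fun s => s.1 + e * s.2) (S : Set (ℝ × ℝ)) :=
    injOn_add_mul fun s hs => he s (by rwa [← Finset.mem_coe, Finset.coe_sub])
  refine ⟨fun a => liftPoint e (a.1 + t * a.2, a.2),
    fun l => dualPoint e (l.1 / (1 + t * l.1), l.2 / (1 + t * l.1)), fun f => ?_, ?_⟩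
  · obtain ⟨-, hl, hal⟩ := mem_incidences.1 f.2
    exact (hal.shear (hL _ hl)).liftPoint_add_dualPoint_apply_one e
  · intro f f' heq
    simp only [liftPoint_add_dualPoint_apply_zero] at heq
    exact Subtype.ext (injOn_abscissa_slope hL hA f.2 f'.2
      (hS (Finset.mem_image_of_mem g f.2) (Finset.mem_image_of_mem g f'.2) heq))

theorem card_incidences_le_maxima (A L : Finset (ℝ × ℝ)) {n : ℕ} (h : A.card + L.card ≤ n) :
    (incidences A L).card ≤ maxMidpointPairs 2 n ∧
      (incidences A L).card ≤ maxSumIndependent 2 n n ∧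
      (incidences A L).card ≤ maxNonparallelUnit 2 n := by
  classical
  obtain ⟨φ, ψ, hsys⟩ := exists_isParabolicSystem A L
  have hA : (A.image φ).card ≤ A.card := Finset.card_image_le
  have hL : (L.image ψ).card ≤ L.card := Finset.card_image_le
  have hφ : ∀ f : incidences A L, φ f.1.1 ∈ A.image φ := fun f =>
    Finset.mem_image_of_mem φ (mem_incidences.1 f.2).1
  have hψ : ∀ f : incidences A L, ψ f.1.2 ∈ L.image ψ := fun f =>
    Finset.mem_image_of_mem ψ (mem_incidences.1 f.2).2.1
  rw [← Fintype.card_coe]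
  exact ⟨hsys.card_le_maxMidpointPairs (by omega) hφ hψ,
    hsys.card_le_maxSumIndependent (by omega) (by omega) hφ hψ,
    hsys.card_le_maxNonparallelUnit (by omega) hφ hψ⟩

end Incidences

section Grid

/-- The integer pairs in `[0, r) × [0, s)`, serving both as points `(x, y)` and as lines
`(slope, intercept)` of the incidence configuration. -/
def grid (r s : ℕ) : Finset (ℝ × ℝ) :=
  (Finset.range r ×ˢ Finset.range s).map (Nat.castEmbedding.prodMap Nat.castEmbedding)

theorem card_grid (r s : ℕ) : (grid r s).card = r * s := by
  rw [grid, Finset.card_map, Finset.card_product, Finset.card_range, Finset.card_range]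

theorem cast_mem_grid {r s i j : ℕ} (hi : i < r) (hj : j < s) : ((i, j) : ℝ × ℝ) ∈ grid r s :=
  Finset.mem_map.2 ⟨(i, j), by simp [hi, hj], rfl⟩

-- With `2 k² - 1` instead of `2 k²`, the case `k = 1` needs one point and one line only, which
-- is what `n = 2` allows.
theorem pow_four_le_card_incidences_grid (k : ℕ) :
    k ^ 4 ≤ (incidences (grid k (2 * k ^ 2 - 1)) (grid k (k ^ 2))).card := by
  let F := Finset.range k ×ˢ Finset.range k ×ˢ Finset.range (k ^ 2)
  have hF : F.card = k ^ 4 := by simp [F]; ring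
  rw [← hF]
  refine Finset.card_le_card_of_injOn
    (fun f => (((f.1 : ℝ), ((f.2.1 * f.1 + f.2.2 : ℕ) : ℝ)), ((f.2.1 : ℝ), (f.2.2 : ℝ)))) ?_ ?_
  · rintro ⟨i, m, b⟩ hf
    simp only [F, Finset.mem_coe, Finset.mem_product, Finset.mem_range] at hf
    obtain ⟨hi, hm, hb⟩ := hf
    have hmi : m * i < k ^ 2 := by nlinarith
    refine mem_incidences.2 ⟨cast_mem_grid hi ?_, cast_mem_grid hm hb, ?_⟩
    · change m * i + b < 2 * k ^ 2 - 1
      omega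
    · simp [Incident]
  · rintro ⟨i, m, b⟩ - ⟨i', m', b'⟩ - heq
    simp only [Prod.mk.injEq, Nat.cast_inj] at heq ⊢
    exact ⟨heq.1.1, heq.2⟩

theorem card_grid_add_card_grid_le {k n : ℕ} (hk : 0 < k) (hn : 3 * k ^ 3 ≤ n + 1) :
    (grid k (2 * k ^ 2 - 1)).card + (grid k (k ^ 2)).card ≤ n := by
  have hsub : k * (2 * k ^ 2 - 1) = 2 * k ^ 3 - k := by
    rw [Nat.mul_sub, mul_one]
    ring_nf
  rw [card_grid, card_grid, hsub, show k * k ^ 2 = k ^ 3 by ring]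
  omega

theorem exists_three_mul_cube_le {n : ℕ} (hn : 2 ≤ n) :
    ∃ k : ℕ, 0 < k ∧ 3 * k ^ 3 ≤ n + 1 ∧ n ≤ (3 * k) ^ 3 := by
  induction n, hn using Nat.le_induction with
  | base => exact ⟨1, by norm_num⟩
  | succ n _ ih =>
    obtain ⟨k, hk, hkn, hnk⟩ := ih
    by_cases hnext : 3 * (k + 1) ^ 3 ≤ n + 2
    · exact ⟨k + 1, k.succ_pos, hnext,
        hnk.trans_lt (Nat.pow_lt_pow_left (by omega) three_ne_zero)⟩
    · have hdouble : (k + 1) ^ 3 ≤ (2 * k) ^ 3 := Nat.pow_le_pow_left (by omega) 3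
      refine ⟨k, hk, by omega, ?_⟩
      rw [mul_pow] at hdouble ⊢
      omega

end Grid

theorem rpow_four_thirds_le {n k : ℕ} (h : n ≤ (3 * k) ^ 3) :
    (n : ℝ) ^ (4 / 3 : ℝ) ≤ 81 * (k : ℝ) ^ 4 := by
  have hcast : (n : ℝ) ≤ (3 * k : ℝ) ^ 3 := by exact_mod_cast h
  calc (n : ℝ) ^ (4 / 3 : ℝ) ≤ ((3 * k : ℝ) ^ 3) ^ (4 / 3 : ℝ) := by gcongr
    _ = (3 * k : ℝ) ^ 4 := by
      rw [← Real.rpow_natCast_mul (by positivity), ← Real.rpow_natCast]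
      norm_num
    _ = 81 * (k : ℝ) ^ 4 := by ring

theorem mul_sqrt_log_le_two_mul_rpow {x : ℝ} (hx : 0 < x) :
    x * √(Real.log x) ≤ 2 * x ^ (4 / 3 : ℝ) := by
  have hlog : Real.log x ≤ (2 * x ^ (1 / 3 : ℝ)) ^ 2 :=
    calc Real.log x ≤ x ^ (2 / 3 : ℝ) / (2 / 3) := Real.log_le_rpow_div hx.le (by norm_num)
      _ ≤ 4 * x ^ (2 / 3 : ℝ) := by linarith [Real.rpow_nonneg hx.le (2 / 3)]
      _ = (2 * x ^ (1 / 3 : ℝ)) ^ 2 := by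
        rw [mul_pow, ← Real.rpow_mul_natCast hx.le]
        norm_num
  calc x * √(Real.log x) ≤ x * (2 * x ^ (1 / 3 : ℝ)) := by
        gcongr
        exact Real.sqrt_le_iff.2 ⟨by positivity, hlog⟩
    _ = 2 * (x ^ (1 : ℝ) * x ^ (1 / 3 : ℝ)) := by rw [Real.rpow_one]; ring
    _ = 2 * x ^ (4 / 3 : ℝ) := by rw [← Real.rpow_add hx]; norm_num

end MinkowskiSum

theorem mainTheorem2_general :
    ∃ c : ℝ, 0 < c ∧ ∀ n : ℕ, 2 ≤ n →
      c * (n : ℝ) ^ (4 / 3 : ℝ) ≤ (MinkowskiSum.maxMidpointPairs 2 n : ℝ) ∧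
      c * (n : ℝ) ^ (4 / 3 : ℝ) ≤ (MinkowskiSum.maxSumIndependent 2 n n : ℝ) ∧
      c * (n : ℝ) ^ (4 / 3 : ℝ) ≤ (MinkowskiSum.maxNonparallelUnit 2 n : ℝ) := by
  refine ⟨1 / 81, by norm_num, fun n hn => ?_⟩
  obtain ⟨k, hk, hkn, hnk⟩ := MinkowskiSum.exists_three_mul_cube_le hn
  have hrpow := MinkowskiSum.rpow_four_thirds_le hnk
  have hgrid := MinkowskiSum.pow_four_le_card_incidences_grid k
  have hle : ∀ {M : ℕ}, (MinkowskiSum.incidences _ _).card ≤ M →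
      1 / 81 * (n : ℝ) ^ (4 / 3 : ℝ) ≤ M := fun {M} hM => by
    have : (k : ℝ) ^ 4 ≤ M := by exact_mod_cast hgrid.trans hM
    linarith
  exact (MinkowskiSum.card_incidences_le_maxima _ _
    (MinkowskiSum.card_grid_add_card_grid_le hk hkn)).imp hle (And.imp hle hle)

theorem mainTheorem2 :
    ∃ c : ℝ, 0 < c ∧ ∀ n : ℕ, 2 ≤ n →
      c * (n * √(Real.log n)) ≤ (MinkowskiSum.maxMidpointPairs 2 n : ℝ) ∧
      c * (n * √(Real.log n)) ≤ (MinkowskiSum.maxSumIndependent 2 n n : ℝ) ∧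
      c * (n * √(Real.log n)) ≤ (MinkowskiSum.maxNonparallelUnit 2 n : ℝ) := by
  obtain ⟨c, hc, h⟩ := mainTheorem2_general
  refine ⟨c / 2, half_pos hc, fun n hn => ?_⟩
  have hlog : c / 2 * (n * √(Real.log n)) ≤ c * (n : ℝ) ^ (4 / 3 : ℝ) := by
    have := MinkowskiSum.mul_sqrt_log_le_two_mul_rpow (x := n) (by positivity)
    nlinarith
  exact (h n hn).imp hlog.trans (And.imp hlog.trans hlog.trans)
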